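/- Let $V$ be a finite set. For a metric $\mu$ on $V$ let $I_\mu(x,y)=\{z:\mu(x,z)+\mu(z,y)=\mu(x,y)\}$; $\mu$ is modular if $I_\mu(x,y)\cap I_\mu(y,z)\cap I_\mu(x,z)\neq\varnothing$ for all $x,y,z\in V$. Let $H_\mu$ be the weighted graph on $V$ whose edges are the pairs $xy$, $x\ne y$, with $\mu(x,y)<\mu(x,z)+\mu(z,y)$ for all $z\in V\setminus\{x,y\}$, with edge weights $w(xy)=\mu(x,y)$. A modular complex $\Gamma$ on $V$ is a graph $H_\mu$ with $\mu$ a modular metric, together with an orientation of its edges such that for every 4-cycle $x_1,x_2,x_3,x_4$, $x_1\to x_2$ implies $x_4\to x_3$. Write $p\preceq q$ if there is a directed path (possibly of length $0$) from $p$ to $q$; joins $\vee$ and meets $\wedge$ in $V$ refer to $\preceq$, and $[p,q]=\{x:p\preceq x\preceq q\}$. Let $\mu_\Gamma$ and $d_\Gamma$ be the path metrics of $\Gamma$ (orientations ignored) with respect to the edge lengths $w$ and $1$. An extended modular complex is a modular complex $\Gamma$ with a binary relation $\sqsubseteq$ on $V$ such that $p\sqsubseteq q$ implies $p\preceq q$;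 $p\sqsubseteq p$ for all $p$; $p\sqsubseteq q$ for every edge $p\to q$; and (a) if $p\sqsubseteq q$, $a\preceq b$ and $a,b\in[p,q]$, then $a\sqsubseteq b$; (b) if $p\sqsubseteq q_1$, $p\sqsubseteq q_2$ and $q_1\vee q_2$ exists, then $p\sqsubseteq q_1\vee q_2$; (c) if $p_1\sqsubseteq q$, $p_2\sqsubseteq q$ and $p_1\wedge p_2$ exists, then $p_1\wedge p_2\sqsubseteq q$. For $p\in V$ let $\mathcal L^+_p=\{q\in V:p\sqsubseteq q\}$, ordered by $\preceq$, and $\mathcal L^-_p=\{q\in V:q\sqsubseteq p\}$, ordered by the reverse of $\preceq$. A modular semilattice is a poset in which any two elements have a meet, every principal ideal $\{x:x\preceq q\}$ is a modular lattice, and $x\vee y\vee z$ exists whenever $x\vee y$, $y\vee z$, $z\vee x$ exist. A valuation of it is a real function $v$ with $v(y)-v(x)>0$ whenever $x\prec y$, and $v(x)+v(y)=v(x\wedge y)+v(x\vee y)$ whenever $x,y$ have a common upper bound. **Lemma.** Let $\Gamma$ be an extended modular complex on a finite set $V$ and let $p\in V$. Then $\mathcal L^+_p$ and $\mathcal L^-_p$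 are modular semilattices, and they are convex in $\Gamma$, i.e. for $\mathcal L\in\{\mathcal L_p^+,\mathcal L_p^-\}$ and all $x,y\in\mathcal L$ the metric interval of $x,y$ is contained in $\mathcal L$, both with respect to $\mu_\Gamma$ and with respect to $d_\Gamma$. Furthermore, $v(a)=\mu_\Gamma(p,a)$ is a valuation of $\mathcal L^+_p$ and of $\mathcal L^-_p$. -/

import Mathlib

/-! ## Metric intervals, convexity, modular metrics -/

/-- The metric interval `I(x, y) = {z | μ(x,z) + μ(z,y) = μ(x,y)}`. -/
def metricInterval {V : Type*} (μ : V → V → ℝ) (x y : V) : Set V :=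
  {z | μ x z + μ z y = μ x y}

/-- A subset is convex if it contains the metric interval of any two of its points. -/
def IsMetricConvex {V : Type*} (μ : V → V → ℝ) (U : Set V) : Prop :=
  ∀ x ∈ U, ∀ y ∈ U, metricInterval μ x y ⊆ U

/-- A metric is modular if every three points have a median. -/
def IsModularMetric {V : Type*} (μ : V → V → ℝ) : Prop :=
  ∀ x y z, (metricInterval μ x y ∩ metricInterval μ y z ∩ metricInterval μ x z).Nonempty

/-! ## Posets given by a relation -/

/-- `j` is the least upper bound of `S` with respect to the relation `r`. -/
def IsJoinOf {α : Type*} (r : α → α → Prop) (S : Set α) (j : α) : Prop :=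
  (∀ x ∈ S, r x j) ∧ ∀ u, (∀ x ∈ S, r x u) → r j u

/-- `m` is the greatest lower bound of `S` with respect to the relation `r`. -/
def IsMeetOf {α : Type*} (r : α → α → Prop) (S : Set α) (m : α) : Prop :=
  (∀ x ∈ S, r m x) ∧ ∀ u, (∀ x ∈ S, r u x) → r u m

/-- The relation `r` is the order of a modular lattice. -/
def IsModularLatticeOrder {α : Type*} (r : α → α → Prop) : Prop :=
  ∃ _ : Lattice α, (∀ x y : α, x ≤ y ↔ r x y) ∧ IsModularLattice α

/-- The relation `r` is the order of a modular (meet-)semilattice: it is a partial order with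
binary meets, all principal ideals are modular lattices, and `x ∨ y ∨ z` exists as soon as
`x ∨ y`, `y ∨ z` and `z ∨ x` exist. -/
structure IsModularSemilattice {α : Type*} (r : α → α → Prop) : Prop where
  isPartialOrder : IsPartialOrder α r
  exists_meet : ∀ x y, ∃ m, IsMeetOf r {x, y} m
  ideal_modular : ∀ p, IsModularLatticeOrder (fun a b : {x // r x p} => r a.1 b.1)
  exists_join : ∀ x y z, (∃ j, IsJoinOf r {x, y} j) → (∃ j, IsJoinOf r {y, z} j) →
    (∃ j, IsJoinOf r {z, x} j) → ∃ j, IsJoinOf r {x, y, z} j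

/-- `v` is a (positive) valuation of the semilattice with order `r`: it is strictly increasing, and
`v x + v y = v (x ∧ y) + v (x ∨ y)` for every upper-bounded pair `x, y`. -/
structure IsValuation {α : Type*} (r : α → α → Prop) (v : α → ℝ) : Prop where
  pos : ∀ x y, r x y → x ≠ y → 0 < v y - v x
  add_eq : ∀ x y, (∃ u, r x u ∧ r y u) →
    ∃ m j, IsMeetOf r {x, y} m ∧ IsJoinOf r {x, y} j ∧ v x + v y = v m + v j

/-! ## Oriented weighted graphs -/

/-- A simple undirected graph with positive edge weights and an edge orientation:
`arc u v` says that there is an edge oriented from `u` to `v`.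
Only the weights `w s(u, v)` of edges matter. -/
structure OrientedWeightedGraph (V : Type*) where
  arc : V → V → Prop
  arc_asymm : ∀ u v, arc u v → ¬ arc v u
  w : Sym2 V → ℝ
  w_pos : ∀ u v, arc u v → 0 < w s(u, v)

namespace OrientedWeightedGraph

variable {V : Type*} (Γ : OrientedWeightedGraph V)

/-- The underlying undirected graph. -/
def graph : SimpleGraph V where
  Adj u v := Γ.arc u v ∨ Γ.arc v u
  symm := ⟨fun _ _ h => h.symm⟩
  loopless := ⟨fun u h => h.elim (fun h => Γ.arc_asymm u u h h) (fun h => Γ.arc_asymm u u h h)⟩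

/-- The path metric with respect to the edge lengths `w` (edge orientations are ignored). -/
noncomputable def pathMetric (x y : V) : ℝ :=
  ⨅ P : Γ.graph.Walk x y, (P.edges.map Γ.w).sum

/-- The path metric with respect to unit edge lengths. -/
noncomputable def unitMetric (x y : V) : ℝ := (Γ.graph.dist x y : ℝ)

/-- The underlying weighted graph is `H_μ`, the minimal weighted graph with path metric `μ`:
its edges are the pairs `xy` with `μ(x,y) < μ(x,z) + μ(z,y)` for all `z ≠ x, y`,
and the weights are given by `μ`. -/
def IsGraphOf (μ : V → V → ℝ) : Prop :=
  (∀ x y, Γ.graph.Adj x y ↔ x ≠ y ∧ ∀ z, z ≠ x → z ≠ y → μ x y < μ x z + μ z y) ∧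
  ∀ x y, Γ.graph.Adj x y → Γ.w s(x, y) = μ x y

/-- The underlying weighted graph is modular: it is `H_μ` for a modular metric `μ`. -/
def IsModular : Prop :=
  ∃ _ : MetricSpace V, IsModularMetric (fun x y : V => dist x y) ∧
    Γ.IsGraphOf (fun x y : V => dist x y)

/-- The orientation is admissible: in every 4-cycle `x₁ x₂ x₃ x₄`,
`x₁ → x₂` implies `x₄ → x₃`. -/
def HasAdmissibleOrientation : Prop :=
  ∀ x₁ x₂ x₃ x₄, x₁ ≠ x₃ → x₂ ≠ x₄ →
    Γ.graph.Adj x₁ x₂ → Γ.graph.Adj x₂ x₃ → Γ.graph.Adj x₃ x₄ → Γ.graph.Adj x₄ x₁ →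
    Γ.arc x₁ x₂ → Γ.arc x₄ x₃

/-- The relation `⪯`: there is a directed path from `p` to `q`. -/
def le : V → V → Prop := Relation.ReflTransGen Γ.arc

/-- A binary relation `R` (written `⊑`) on the vertices is admissible. -/
structure IsAdmissibleRel (R : V → V → Prop) : Prop where
  le_of_rel : ∀ p q, R p q → Γ.le p q
  refl : ∀ p, R p p
  of_arc : ∀ p q, Γ.arc p q → R p q
  interval : ∀ p q a b, R p q → Γ.le a b → Γ.le p a → Γ.le a q → Γ.le p b → Γ.le b q → R a b
  join : ∀ p q₁ q₂ q, R p q₁ → R p q₂ → IsJoinOf Γ.le {q₁, q₂} q → R p q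
  meet : ∀ p₁ p₂ q p, R p₁ q → R p₂ q → IsMeetOf Γ.le {p₁, p₂} p → R p q

end OrientedWeightedGraph

/-- A modular complex: an admissible orientation of an orientable modular graph. -/
structure ModularComplex (V : Type*) extends OrientedWeightedGraph V where
  modular : toOrientedWeightedGraph.IsModular
  admissible : toOrientedWeightedGraph.HasAdmissibleOrientation

/-- An extended modular complex: a modular complex with an admissible relation `⊑`. -/
structure ExtendedModularComplex (V : Type*) extends ModularComplex V where
  sqle : V → V → Prop
  sqle_admissible : toOrientedWeightedGraph.IsAdmissibleRel sqle

namespace ExtendedModularComplex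

variable {V : Type*} (Γ : ExtendedModularComplex V)

/-- The set `L⁺_p = {q | p ⊑ q}`. -/
def Lplus (p : V) : Set V := {q | Γ.sqle p q}

/-- The set `L⁻_p = {q | q ⊑ p}`. -/
def Lminus (p : V) : Set V := {q | Γ.sqle q p}

/-- The order of the poset `L⁺_p`: the restriction of `⪯`. -/
def plusOrder (p : V) (a b : Γ.Lplus p) : Prop := Γ.le a.1 b.1

/-- The order of the poset `L⁻_p`: the restriction of the reverse of `⪯`. -/
def minusOrder (p : V) (a b : Γ.Lminus p) : Prop := Γ.le b.1 a.1

end ExtendedModularComplex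

/-! ## The graph of a modular metric -/

namespace ModularMetric

variable {V : Type*} [MetricSpace V] {G : SimpleGraph V}

/-! The weights can be discarded: a quadrangle argument shows that all geodesics of a modular metric
between two points have equally many edges, so the weighted and unit metrics have the same intervals
(`between_iff`).

The order then becomes metric. By admissibility on squares, `x ⪯ y` holds iff every edge on every
geodesic from `x` to `y` points towards `y` (`le_iff_geodesics`). Hence order intervals are metric
intervals and distance is additive along `⪯`. Principal filters are convex (`le_of_between_of_le`),
so a median of `x`, `y` and a common upper bound is the join of `x` and `y`; meets are dual.

If `z` lies between `x, y ∈ L⁺_p`, then `x ∧ z` and `y ∧ z` lie in `L⁺_p` by axiom (a), and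
distances force their join to be `z`, so (b) applies. As meets and joins lie between `x` and `y`,
the distance from `p` is a valuation, which makes principal ideals modular. Triple joins exist
because a median of the three pairwise joins bounds all three elements. `L⁻_p` follows by reversing
all arcs. -/

/-- `G` is the underlying graph of `H_μ`, where `μ` is the distance of the metric space `V`. -/
def IsIntervalGraph (G : SimpleGraph V) : Prop :=
  ∀ x y, G.Adj x y ↔ x ≠ y ∧ ∀ z, z ≠ x → z ≠ y → dist x y < dist x z + dist z y

theorem exists_median (hm : IsModularMetric (fun x y : V => dist x y)) (x y z : V) :
    ∃ m, dist x m + dist m y = dist x y ∧ dist y m + dist m z = dist y z ∧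
      dist x m + dist m z = dist x z := by
  obtain ⟨m, ⟨h1, h2⟩, h3⟩ := hm x y z
  exact ⟨m, h1, h2, h3⟩

theorem exists_adj_between [Finite V] (hG : IsIntervalGraph G) {x y : V} (hxy : x ≠ y) :
    ∃ t, G.Adj x t ∧ dist x t + dist t y = dist x y := by
  -- A nearest point `t ≠ x` of the interval is a neighbour of `x`: a `z` between `x` and `t` would
  -- be nearer.
  obtain ⟨t, ⟨htx, ht⟩, hmin⟩ := Set.exists_min_image
    {t : V | t ≠ x ∧ dist x t + dist t y = dist x y} (fun t => dist x t) (Set.toFinite _)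
    ⟨y, hxy.symm, by simp⟩
  refine ⟨t, (hG x t).2 ⟨htx.symm, fun z hzx hzt => ?_⟩, ht⟩
  by_contra! hle
  have h1 := dist_triangle x z y
  have h2 := dist_triangle z t y
  have h3 := hmin z ⟨hzx, by linarith⟩
  have h4 := dist_pos.2 hzt
  linarith

theorem adj_dichotomy (hm : IsModularMetric (fun x y : V => dist x y)) (hG : IsIntervalGraph G)
    {x y : V} (h : G.Adj x y) (z : V) :
    dist x z = dist x y + dist y z ∨ dist y z = dist x y + dist x z := by
  obtain ⟨m, h1, h2, h3⟩ := exists_median hm x y z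
  by_cases hx : m = x
  · subst hx; right; rw [dist_comm m y]; exact h2.symm
  by_cases hy : m = y
  · subst hy; left; exact h3.symm
  exact absurd (((hG x y).1 h).2 m hx hy) (by linarith)

theorem dist_of_adj_adj (hm : IsModularMetric (fun x y : V => dist x y)) (hG : IsIntervalGraph G)
    {x v y : V} (hx : G.Adj v x) (hy : G.Adj v y) (hxy : x ≠ y) :
    dist x y = dist v x + dist v y := by
  have h1 := adj_dichotomy hm hG hx y
  have h2 := adj_dichotomy hm hG hy x
  have h3 := dist_pos.2 hxy
  have := dist_comm x y
  rcases h1 with h1 | h1 <;> rcases h2 with h2 | h2 <;> linarith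

/-- A median of `x, y, z` works: the distances force `dist x m = dist v y`, and the first vertex `t`
on the way from `x` to `m` is already at that distance, so `t = m`. -/
theorem exists_quadrangle [Finite V] (hm : IsModularMetric (fun x y : V => dist x y))
    (hG : IsIntervalGraph G) {v x y z : V} (hx : G.Adj v x) (hy : G.Adj v y) (hxy : x ≠ y)
    (hxz : dist v z = dist v x + dist x z) (hyz : dist v z = dist v y + dist y z) :
    ∃ m, G.Adj x m ∧ G.Adj y m ∧ dist x z = dist x m + dist m z ∧
      dist y z = dist y m + dist m z := by
  obtain ⟨m, h1, h2, h3⟩ := exists_median hm x y z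
  have key : ∀ {x y : V}, G.Adj v x → G.Adj v y → x ≠ y → dist x m + dist m y = dist x y →
      dist v z = dist v x + dist x z → dist v z = dist v y + dist y z →
      dist y m + dist m z = dist y z → dist x m + dist m z = dist x z → G.Adj x m := by
    intro x y hx hy hxy h1 hxz hyz h2 h3
    have h4 := dist_of_adj_adj hm hG hx hy hxy
    have hvx := dist_pos.2 hx.ne
    have hvy := dist_pos.2 hy.ne
    have hym := dist_comm y m
    have hxm : x ≠ m := by
      rintro rfl
      rw [dist_self] at h1 h3
      linarith
    obtain ⟨t, ht, htm⟩ := exists_adj_between hG hxm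
    have hxt := dist_pos.2 ht.ne
    have htz : dist x t + dist t z = dist x z := by
      linarith [dist_triangle x t z, dist_triangle t m z]
    have hty : dist x t + dist t y = dist x y := by
      linarith [dist_triangle x t y, dist_triangle t m y]
    have hvt : v ≠ t := by
      rintro rfl
      rw [dist_comm v x] at hxz
      linarith
    have h5 := dist_of_adj_adj hm hG hx.symm ht hvt
    have h6 := adj_dichotomy hm hG hy t
    have : dist t m = 0 := by
      rw [dist_comm x v] at h5
      rw [dist_comm y t] at h6
      rcases h6 with h6 | h6 <;> linarith
    rw [← dist_eq_zero.1 this]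
    exact ht
  refine ⟨m, key hx hy hxy h1 hxz hyz h2 h3, key hy hx hxy.symm ?_ hyz hxz h3 h2, h3.symm, h2.symm⟩
  rw [dist_comm y m, dist_comm m x, dist_comm y x, add_comm]
  exact h1

/-! ### Edge counts of geodesics and the unit metric -/

/-- There is a geodesic with `n` edges from `x` to `z`. -/
inductive HasGeodesic (G : SimpleGraph V) (z : V) : ℕ → V → Prop
  | nil : HasGeodesic G z 0 z
  | cons {n : ℕ} {x y : V} : G.Adj x y → dist x z = dist x y + dist y z → HasGeodesic G z n y →
      HasGeodesic G z (n + 1) x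

theorem exists_hasGeodesic [Finite V] (hG : IsIntervalGraph G) (x z : V) :
    ∃ n, HasGeodesic G z n x := by
  have wf : WellFounded (fun a b : V => dist a z < dist b z) :=
    @Finite.wellFounded_of_trans_of_irrefl V _ _ ⟨fun _ _ _ => lt_trans⟩ ⟨fun _ => lt_irrefl _⟩
  induction x using wf.induction with
  | _ x ih =>
    by_cases hxz : x = z
    · exact ⟨0, hxz ▸ .nil⟩
    obtain ⟨t, ht, htz⟩ := exists_adj_between hG hxz
    have := dist_pos.2 ht.ne
    obtain ⟨n, hn⟩ := ih t (by linarith)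
    exact ⟨n + 1, .cons ht htz.symm hn⟩

theorem HasGeodesic.unique [Finite V] (hm : IsModularMetric (fun x y : V => dist x y))
    (hG : IsIntervalGraph G) {z : V} {n : ℕ} : ∀ {k : ℕ} {x : V}, HasGeodesic G z n x →
      HasGeodesic G z k x → k = n := by
  induction n with
  | zero =>
    intro k x h h'
    cases h
    cases h' with
    | nil => rfl
    | @cons _ _ y h1 h2 h3 =>
      have := dist_pos.2 h1.ne
      rw [dist_self] at h2
      linarith [dist_nonneg (x := y) (y := z)]
  | succ n ih =>
    intro k x h h'
    cases h with
    | @cons _ _ y h1 h2 h3 =>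
    cases h' with
    | nil =>
      have := dist_pos.2 h1.ne
      rw [dist_self] at h2
      linarith [dist_nonneg (x := y) (y := z)]
    | @cons k _ y' h1' h2' h3' =>
      by_cases hy : y = y'
      · subst hy; rw [ih h3 h3']
      -- Both geodesics are compared with geodesics that share a tail from `m`.
      obtain ⟨m, a1, a2, a3, a4⟩ := exists_quadrangle hm hG h1 h1' hy h2 h2'
      obtain ⟨l, hl⟩ := exists_hasGeodesic hG m z
      have e := ih h3 (.cons a1 a3 hl)
      subst e
      rw [ih (.cons a2 a4 hl) h3']

theorem HasGeodesic.exists_walk {z : V} {n : ℕ} {x : V} (h : HasGeodesic G z n x) :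
    ∃ P : G.Walk x z, P.length = n ∧ ∀ w : Sym2 V → ℝ, (∀ a b, G.Adj a b → w s(a, b) = dist a b) →
      (P.edges.map w).sum = dist x z := by
  induction h with
  | nil => exact ⟨.nil, rfl, by simp⟩
  | cons h1 h2 _ ih =>
    obtain ⟨P, hP, hw⟩ := ih
    refine ⟨.cons h1 P, by simp [hP], fun w hw' => ?_⟩
    simp [hw w hw', hw' _ _ h1, h2]

/-- Each edge of a walk changes the geodesic edge count to `z` by exactly one. -/
theorem HasGeodesic.le_length [Finite V] (hm : IsModularMetric (fun x y : V => dist x y))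
    (hG : IsIntervalGraph G) {x z : V} (P : G.Walk x z) :
    ∀ {n : ℕ}, HasGeodesic G z n x → n ≤ P.length := by
  induction P with
  | nil => intro n h; rw [HasGeodesic.unique hm hG .nil h]; simp
  | @cons x y z h P ih =>
    intro n hn
    rw [SimpleGraph.Walk.length_cons]
    rcases adj_dichotomy hm hG h z with h1 | h1
    · obtain ⟨k, hk⟩ := exists_hasGeodesic hG y z
      rw [HasGeodesic.unique hm hG (.cons h h1 hk) hn]
      exact Nat.succ_le_succ (ih hk)
    · rw [dist_comm x y] at h1
      have := ih (.cons h.symm h1 hn)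
      omega

theorem hasGeodesic_dist [Finite V] (hm : IsModularMetric (fun x y : V => dist x y))
    (hG : IsIntervalGraph G) (x z : V) : HasGeodesic G z (G.dist x z) x := by
  obtain ⟨n, hn⟩ := exists_hasGeodesic hG x z
  obtain ⟨P, hP, -⟩ := hn.exists_walk
  obtain ⟨Q, hQ⟩ := P.reachable.exists_walk_length_eq_dist
  have h1 := HasGeodesic.le_length hm hG Q hn
  have h2 := SimpleGraph.dist_le P
  have : G.dist x z = n := by omega
  rwa [this]

theorem connected [Finite V] [Nonempty V] (hG : IsIntervalGraph G) : G.Connected := by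
  refine ⟨fun x z => ?_⟩
  obtain ⟨n, hn⟩ := exists_hasGeodesic hG x z
  obtain ⟨P, -⟩ := hn.exists_walk
  exact P.reachable

theorem graph_dist_of_adj [Finite V] (hm : IsModularMetric (fun x y : V => dist x y))
    (hG : IsIntervalGraph G) {x y z : V} (h : G.Adj x y) (hd : dist x z = dist x y + dist y z) :
    G.dist x z = G.dist y z + 1 :=
  HasGeodesic.unique hm hG (.cons h hd (hasGeodesic_dist hm hG y z)) (hasGeodesic_dist hm hG x z)

theorem graph_dist_dichotomy [Finite V] (hm : IsModularMetric (fun x y : V => dist x y))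
    (hG : IsIntervalGraph G) {x y : V} (h : G.Adj x y) (z : V) :
    G.dist x z = G.dist y z + 1 ∨ G.dist y z = G.dist x z + 1 := by
  rcases adj_dichotomy hm hG h z with h1 | h1
  · exact .inl (graph_dist_of_adj hm hG h h1)
  · exact .inr (graph_dist_of_adj hm hG h.symm (by rw [dist_comm y x]; exact h1))

/-- Metric intervals agree with the intervals of the unweighted graph. -/
theorem between_iff [Finite V] (hm : IsModularMetric (fun x y : V => dist x y))
    (hG : IsIntervalGraph G) (x y z : V) :
    dist x y + dist y z = dist x z ↔ G.dist x y + G.dist y z = G.dist x z := by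
  have : Nonempty V := ⟨x⟩
  have hc := connected hG
  induction hn : G.dist x y generalizing x with
  | zero =>
    rw [hc.dist_eq_zero_iff] at hn
    subst hn
    simp
  | succ n ih =>
    have hne : x ≠ y := by rintro rfl; simp at hn
    obtain ⟨t, ht, hty⟩ := exists_adj_between hG hne
    have h1 := graph_dist_of_adj hm hG ht hty.symm
    have h2 := ih t (by omega)
    -- If the first step `x t` towards `y` leads away from `z`, both equalities fail; otherwise both
    -- reduce to `t`.
    rcases adj_dichotomy hm hG ht z with h3 | h3
    · have h4 := graph_dist_of_adj hm hG ht h3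
      constructor
      · intro h
        have := h2.1 (by linarith)
        omega
      · intro h
        have := h2.2 (by omega)
        linarith
    · have h4 := graph_dist_of_adj (z := z) hm hG ht.symm (by rw [dist_comm t x]; exact h3)
      have h5 := dist_pos.2 ht.ne
      constructor
      · intro h
        linarith [dist_triangle t y z]
      · intro h
        have := hc.dist_triangle (u := t) (v := y) (w := z)
        omega

end ModularMetric

/-! ## Modular complexes -/

namespace ModularComplex

variable {V : Type*} (Γ : ModularComplex V)

/-- The modular complex with all edges reversed. -/
def reverse : ModularComplex V where
  arc u v := Γ.arc v u
  arc_asymm u v h := Γ.arc_asymm v u h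
  w := Γ.w
  w_pos u v h := by rw [Sym2.eq_swap]; exact Γ.w_pos v u h
  modular := by
    obtain ⟨i, h1, h2, h3⟩ := Γ.modular
    exact ⟨i, h1, fun x y => or_comm.trans (h2 x y), fun x y h => h3 x y h.symm⟩
  admissible x₁ x₂ x₃ x₄ h13 h24 h1 h2 h3 h4 h :=
    Γ.admissible x₂ x₁ x₄ x₃ h24 h13 h1 h4 h3 h2 h

theorem reverse_graph : Γ.reverse.graph = Γ.graph := by
  ext x y
  exact or_comm

theorem reverse_le (x y : V) : Γ.reverse.le x y ↔ Γ.le y x :=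
  Relation.reflTransGen_swap

theorem dist_comm (x y : V) : Γ.graph.dist x y = Γ.graph.dist y x :=
  SimpleGraph.dist_comm

variable [Finite V]

theorem connected [Nonempty V] : Γ.graph.Connected := by
  obtain ⟨i, h1, h2, h3⟩ := Γ.modular
  exact ModularMetric.connected h2

theorem dist_triangle (x y z : V) :
    Γ.graph.dist x z ≤ Γ.graph.dist x y + Γ.graph.dist y z :=
  have : Nonempty V := ⟨x⟩
  Γ.connected.dist_triangle

theorem dist_eq_zero_iff {x y : V} : Γ.graph.dist x y = 0 ↔ x = y :=
  have : Nonempty V := ⟨x⟩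
  Γ.connected.dist_eq_zero_iff

/-- The path metric is a metric, and its intervals are those of the unit metric. -/
theorem pathMetric_spec : ∃ _ : MetricSpace V, (∀ x y, Γ.pathMetric x y = dist x y) ∧
    ∀ x y z : V, dist x y + dist y z = dist x z ↔
      Γ.graph.dist x y + Γ.graph.dist y z = Γ.graph.dist x z := by
  obtain ⟨i, hm, hG, hw⟩ := Γ.modular
  refine ⟨i, fun x y => ?_, ModularMetric.between_iff hm hG⟩
  obtain ⟨n, hn⟩ := ModularMetric.exists_hasGeodesic hG x y
  obtain ⟨P, -, hP⟩ := hn.exists_walk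
  have hP := hP Γ.w hw
  have : Nonempty (Γ.graph.Walk x y) := ⟨P⟩
  have hle : ∀ {x y : V} (Q : Γ.graph.Walk x y), dist x y ≤ (Q.edges.map Γ.w).sum := by
    intro x y Q
    induction Q with
    | nil => simp
    | @cons x y z h Q ih =>
      rw [SimpleGraph.Walk.edges_cons, List.map_cons, List.sum_cons, hw _ _ h]
      linarith [_root_.dist_triangle x y z]
  refine le_antisymm ?_ (le_ciInf hle)
  rw [← hP]
  exact ciInf_le ⟨dist x y, by rintro _ ⟨Q, rfl⟩; exact hle Q⟩ P

theorem exists_median (x y z : V) :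
    ∃ m, Γ.graph.dist x m + Γ.graph.dist m y = Γ.graph.dist x y ∧
      Γ.graph.dist y m + Γ.graph.dist m z = Γ.graph.dist y z ∧
      Γ.graph.dist x m + Γ.graph.dist m z = Γ.graph.dist x z := by
  obtain ⟨i, hm, hG, hw⟩ := Γ.modular
  obtain ⟨m, h1, h2, h3⟩ := ModularMetric.exists_median hm x y z
  exact ⟨m, (ModularMetric.between_iff hm hG _ _ _).1 h1,
    (ModularMetric.between_iff hm hG _ _ _).1 h2, (ModularMetric.between_iff hm hG _ _ _).1 h3⟩

theorem dist_dichotomy {y z : V} (h : Γ.graph.Adj y z) (x : V) :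
    Γ.graph.dist x y = Γ.graph.dist x z + 1 ∨ Γ.graph.dist x z = Γ.graph.dist x y + 1 := by
  obtain ⟨i, hm, hG, hw⟩ := Γ.modular
  have := ModularMetric.graph_dist_dichotomy hm hG h x
  rwa [Γ.dist_comm y x, Γ.dist_comm z x] at this

theorem exists_adj_dist {x y : V} (h : x ≠ y) :
    ∃ t, Γ.graph.Adj t y ∧ Γ.graph.dist x y = Γ.graph.dist x t + 1 := by
  have : Nonempty V := ⟨x⟩
  obtain ⟨P, hP⟩ := Γ.connected.exists_walk_length_eq_dist y x
  cases P with
  | nil => exact absurd rfl h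
  | @cons _ t _ ht P =>
    refine ⟨t, ht.symm, ?_⟩
    rw [SimpleGraph.Walk.length_cons] at hP
    have h1 := SimpleGraph.dist_le P
    have h2 := Γ.dist_dichotomy ht x
    rw [Γ.dist_comm y x] at hP
    rw [Γ.dist_comm t x] at h1
    omega

/-- The two neighbours of `z` are at distance 2, since adjacent vertices are never equidistant from
`x`; their median with `x` is the fourth corner. -/
theorem exists_quadrangle {x y t z : V} (hy : Γ.graph.Adj y z) (ht : Γ.graph.Adj t z)
    (hyt : y ≠ t) (h1 : Γ.graph.dist x z = Γ.graph.dist x y + 1)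
    (h2 : Γ.graph.dist x z = Γ.graph.dist x t + 1) :
    ∃ s, Γ.graph.Adj s y ∧ Γ.graph.Adj s t ∧ Γ.graph.dist x y = Γ.graph.dist x s + 1 := by
  obtain ⟨s, a1, a2, a3⟩ := Γ.exists_median x y t
  have h3 : Γ.graph.dist y t ≤ 2 := by
    have := Γ.dist_triangle y z t
    rw [SimpleGraph.dist_eq_one_iff_adj.2 hy, SimpleGraph.dist_eq_one_iff_adj.2 ht.symm] at this
    exact this
  have h4 : Γ.graph.dist y t ≠ 0 := fun h => hyt (Γ.dist_eq_zero_iff.1 h)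
  have h5 : Γ.graph.dist y t ≠ 1 := fun h => by
    have := Γ.dist_dichotomy (SimpleGraph.dist_eq_one_iff_adj.1 h) x
    omega
  have h6 := Γ.dist_comm y s
  refine ⟨s, SimpleGraph.dist_eq_one_iff_adj.1 ?_, SimpleGraph.dist_eq_one_iff_adj.1 ?_, ?_⟩ <;>
    omega

/-! ### Directed geodesics and the order -/

/-- Opposite edges of a strip of squares are oriented in parallel. -/
theorem arc_of_strip {x x' : V} (hx : Γ.arc x x') {k : ℕ} : ∀ {y y' : V}, Γ.graph.Adj y y' →
    Γ.graph.dist x y = k → Γ.graph.dist x' y' = k → Γ.graph.dist x y' = k + 1 →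
    Γ.graph.dist x' y = k + 1 → Γ.arc y y' := by
  induction k with
  | zero =>
    intro y y' _ h1 h2 _ _
    rw [← Γ.dist_eq_zero_iff.1 h1, ← Γ.dist_eq_zero_iff.1 h2]
    exact hx
  | succ k ih =>
    intro y y' hy h1 h2 h3 h4
    have hne : x ≠ y := by rintro rfl; simp at h1
    obtain ⟨s, hs, hs'⟩ := Γ.exists_adj_dist hne
    have h5 := Γ.dist_dichotomy hs x'
    have h6 := Γ.dist_triangle x' x s
    have h7 : Γ.graph.dist x' x = 1 := SimpleGraph.dist_eq_one_iff_adj.2 (.inr hx)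
    have hsy : s ≠ y' := by rintro rfl; omega
    -- Seen from `x'`, both `s` and `y'` precede `y`; the quadrangle supplies the last square `s t
    -- y' y` of the strip.
    obtain ⟨t, ht, ht', hd⟩ :=
      Γ.exists_quadrangle (x := x') (y := s) (t := y') hs hy.symm hsy (by omega) (by omega)
    have h8 := Γ.dist_triangle x x' t
    rw [Γ.dist_comm x x', h7] at h8
    have h9 := Γ.dist_dichotomy ht' x
    have hst := ih (y := s) (y' := t) ht.symm (by omega) (by omega) (by omega) (by omega)
    have hty : t ≠ y := by rintro rfl; omega
    exact Γ.admissible s t y' y hsy hty (.inl hst) ht' hy.symm hs.symm hst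

theorem le_of_geodesics {x y : V} (h : ∀ a b, Γ.graph.Adj a b →
    Γ.graph.dist x a + 1 + Γ.graph.dist b y = Γ.graph.dist x y → Γ.arc a b) : Γ.le x y := by
  induction hn : Γ.graph.dist x y generalizing y with
  | zero => rw [Γ.dist_eq_zero_iff.1 hn]; exact .refl
  | succ n ih =>
    have hne : x ≠ y := by rintro rfl; simp at hn
    obtain ⟨t, ht, hd⟩ := Γ.exists_adj_dist hne
    refine .tail (b := t) (ih (fun a b hab hd' => h a b hab ?_) (by omega)) (h t y ht (by simp; omega))
    have h1 := Γ.dist_triangle b t y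
    have h2 := Γ.dist_triangle x a y
    have h3 := Γ.dist_triangle a b y
    have h4 := SimpleGraph.dist_eq_one_iff_adj.2 ht
    have h5 := SimpleGraph.dist_eq_one_iff_adj.2 hab
    omega

theorem geodesics_arc {x y z : V} (h : ∀ a b, Γ.graph.Adj a b →
    Γ.graph.dist x a + 1 + Γ.graph.dist b y = Γ.graph.dist x y → Γ.arc a b) (hyz : Γ.arc y z) :
    Γ.graph.dist x z = Γ.graph.dist x y + 1 ∧ ∀ a b, Γ.graph.Adj a b →
      Γ.graph.dist x a + 1 + Γ.graph.dist b z = Γ.graph.dist x z → Γ.arc a b := by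
  induction hn : Γ.graph.dist x y using Nat.strong_induction_on generalizing y z with
  | _ n ih =>
    subst hn
    have hadj : Γ.graph.Adj y z := .inl hyz
    have hxz : Γ.graph.dist x z = Γ.graph.dist x y + 1 := by
      rcases Γ.dist_dichotomy hadj x with h1 | h1
      · exact absurd (h z y hadj.symm (by simp; omega)) (Γ.arc_asymm _ _ hyz)
      · exact h1
    -- every predecessor of `z` is directed towards `z` and all geodesics to it are directed
    have key : ∀ t, Γ.graph.Adj t z → Γ.graph.dist x z = Γ.graph.dist x t + 1 →
        Γ.arc t z ∧ ∀ a b, Γ.graph.Adj a b →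
          Γ.graph.dist x a + 1 + Γ.graph.dist b t = Γ.graph.dist x t → Γ.arc a b := by
      intro t ht hd
      by_cases hty : t = y
      · subst hty; exact ⟨hyz, h⟩
      -- In the square `s y z t`, the arc `y → z` gives `s → t` and the arc `s → y` gives `t → z`;
      -- induction then applies to `s`, which is nearer to `x`.
      obtain ⟨s, hs, hst, hds⟩ := Γ.exists_quadrangle hadj ht (Ne.symm hty) hxz hd
      have hsz : s ≠ z := by rintro rfl; omega
      have hsy : Γ.arc s y := h s y hs (by simp; omega)
      have hst' : Γ.arc s t :=
        Γ.admissible y z t s (Ne.symm hty) hsz.symm hadj ht.symm hst.symm hs hyz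
      refine ⟨Γ.admissible s y z t hsz (Ne.symm hty) hs hadj ht.symm hst.symm hsy, ?_⟩
      refine (ih _ (by omega) (y := s) (z := t) (fun a b hab hd' => h a b hab ?_) hst' rfl).2
      have h1 := Γ.dist_triangle b s y
      have h2 := Γ.dist_triangle x a y
      have h3 := Γ.dist_triangle a b y
      have h4 := SimpleGraph.dist_eq_one_iff_adj.2 hs
      have h5 := SimpleGraph.dist_eq_one_iff_adj.2 hab
      omega
    refine ⟨hxz, fun a b hab hd => ?_⟩
    by_cases hbz : b = z
    · subst hbz
      exact (key a hab (by simpa using hd.symm)).1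
    obtain ⟨t, ht, hbt⟩ := Γ.exists_adj_dist hbz
    have h1 := Γ.dist_triangle x b t
    have h2 := Γ.dist_triangle x a b
    have h5 := SimpleGraph.dist_eq_one_iff_adj.2 hab
    have h6 := Γ.dist_dichotomy ht x
    exact (key t ht (by omega)).2 a b hab (by omega)

theorem le_iff_geodesics {x y : V} : Γ.le x y ↔ ∀ a b, Γ.graph.Adj a b →
    Γ.graph.dist x a + 1 + Γ.graph.dist b y = Γ.graph.dist x y → Γ.arc a b := by
  refine ⟨fun h => ?_, Γ.le_of_geodesics⟩
  induction h with
  | refl => intro a b _ h; simp at h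
  | tail _ hyz ih => exact (Γ.geodesics_arc ih hyz).2

theorem dist_add_of_le {x y z : V} (hxy : Γ.le x y) (hyz : Γ.le y z) :
    Γ.graph.dist x y + Γ.graph.dist y z = Γ.graph.dist x z := by
  induction hyz with
  | refl => simp
  | @tail u v hu huv ih =>
    have h1 := (Γ.geodesics_arc (Γ.le_iff_geodesics.1 hu) huv).1
    have h2 := (Γ.geodesics_arc (Γ.le_iff_geodesics.1 (hxy.trans hu)) huv).1
    omega

theorem le_antisymm {x y : V} (hxy : Γ.le x y) (hyx : Γ.le y x) : x = y := by
  have := Γ.dist_add_of_le hxy hyx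
  rw [SimpleGraph.dist_self] at this
  exact Γ.dist_eq_zero_iff.1 (by omega)

theorem le_of_between {x y z : V} (h : Γ.le x z)
    (hd : Γ.graph.dist x y + Γ.graph.dist y z = Γ.graph.dist x z) : Γ.le x y ∧ Γ.le y z := by
  rw [Γ.le_iff_geodesics] at h
  constructor <;> refine Γ.le_iff_geodesics.2 fun a b hab hd' => h a b hab ?_
  all_goals
    have h1 := Γ.dist_triangle b y z
    have h2 := Γ.dist_triangle x y a
    have h3 := Γ.dist_triangle x a z
    have h4 := Γ.dist_triangle a b z
    have h5 := SimpleGraph.dist_eq_one_iff_adj.2 hab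
    omega

/-! ### Convexity of filters, joins and meets -/

/-- One step of filter convexity. The bad case is an arc `z → x` with `z` farther from `p` than `x`:
a strip from an arc `m → t`, where `m ⪯ x, y`, then forces `x → z`. -/
theorem le_of_between_adj {p x y z : V} (hx : Γ.le p x) (hy : Γ.le p y) (hxz : Γ.graph.Adj x z)
    (hz : Γ.graph.dist x y = Γ.graph.dist z y + 1) : Γ.le p z := by
  rcases hxz with harc | harc
  · exact hx.tail harc
  have hxz : Γ.graph.Adj x z := .inr harc
  rcases Γ.dist_dichotomy hxz p with h1 | h1
  · have h2 := SimpleGraph.dist_eq_one_iff_adj.2 hxz.symm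
    exact (Γ.le_of_between hx (by omega)).1
  exfalso
  obtain ⟨m, a1, a2, a3⟩ := Γ.exists_median p x y
  have hmx := (Γ.le_of_between hx a1).2
  have hmy := (Γ.le_of_between hy a3).2
  obtain ⟨t, b1, b2, b3⟩ := Γ.exists_median m z y
  have c1 := Γ.dist_triangle p m z
  have c2 := Γ.dist_dichotomy hxz m
  have c3 := Γ.dist_comm m x
  have c4 := Γ.dist_comm z t
  -- Twice this distance is `d(m,z) + d(m,y) - d(z,y)`, which equals 2.
  have hmt : Γ.graph.dist m t = 1 := by omega
  have hmt' : Γ.arc m t := by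
    rw [Γ.le_iff_geodesics] at hmy
    exact hmy m t (SimpleGraph.dist_eq_one_iff_adj.1 hmt) (by simp; omega)
  have c5 := Γ.dist_triangle x t y
  have c6 := Γ.dist_triangle x m t
  have c7 := Γ.dist_comm x t
  exact Γ.arc_asymm _ _ harc
    (Γ.arc_of_strip hmt' (k := Γ.graph.dist m x) hxz rfl (by omega) (by omega) (by omega))

/-- Principal filters are convex. -/
theorem le_of_between_of_le {p x y z : V} (hx : Γ.le p x) (hy : Γ.le p y)
    (hd : Γ.graph.dist x z + Γ.graph.dist z y = Γ.graph.dist x y) : Γ.le p z := by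
  induction hn : Γ.graph.dist x z generalizing x with
  | zero => rwa [← Γ.dist_eq_zero_iff.1 hn]
  | succ n ih =>
    have hne : z ≠ x := by rintro rfl; simp at hn
    obtain ⟨t, ht, hzt⟩ := Γ.exists_adj_dist hne
    have h1 := Γ.dist_triangle t z y
    have h2 := Γ.dist_triangle x t y
    have h3 := SimpleGraph.dist_eq_one_iff_adj.2 ht.symm
    have h4 := Γ.dist_comm z x
    have h5 := Γ.dist_comm z t
    exact ih (Γ.le_of_between_adj hx hy ht.symm (by omega)) (by omega) (by omega)

theorem exists_join {x y u : V} (hx : Γ.le x u) (hy : Γ.le y u) :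
    ∃ j, IsJoinOf Γ.le {x, y} j ∧
      Γ.graph.dist x j + Γ.graph.dist j y = Γ.graph.dist x y := by
  have ex : ∀ u, Γ.le x u → Γ.le y u → ∃ j, Γ.le x j ∧ Γ.le y j ∧ Γ.le j u ∧
      Γ.graph.dist x j + Γ.graph.dist j y = Γ.graph.dist x y := by
    intro u hx hy
    obtain ⟨j, h1, h2, h3⟩ := Γ.exists_median x y u
    exact ⟨j, (Γ.le_of_between hx h3).1, (Γ.le_of_between hy h2).1, (Γ.le_of_between hx h3).2, h1⟩
  obtain ⟨j, hxj, hyj, -, hd⟩ := ex u hx hy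
  refine ⟨j, ⟨by rintro _ (rfl | rfl) <;> assumption, fun v hv => ?_⟩, hd⟩
  obtain ⟨k, hxk, hyk, hkv, hd'⟩ := ex v (hv x (by simp)) (hv y (by simp))
  -- The candidates from `u` and `v` coincide: `t` is above `y` by convexity and below both, while
  -- `j` and `k` lie on geodesics from `x` to `y`, so `t = j = k`.
  obtain ⟨t, a1, a2, a3⟩ := Γ.exists_median x j k
  have hyt := Γ.le_of_between_of_le hyj hyk a2
  have htj := Γ.le_of_between hxj a1
  have htk := Γ.le_of_between hxk a3
  have b1 := Γ.dist_add_of_le hyt htj.2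
  have b2 := Γ.dist_add_of_le hyt htk.2
  have b3 := Γ.dist_triangle x t y
  have b4 := Γ.dist_comm t y
  have b5 := Γ.dist_comm j y
  have b6 := Γ.dist_comm k y
  have e1 : t = j := Γ.dist_eq_zero_iff.1 (by omega)
  have e2 : t = k := Γ.dist_eq_zero_iff.1 (by omega)
  rwa [← e1, e2]

theorem exists_meet {x y u : V} (hx : Γ.le u x) (hy : Γ.le u y) :
    ∃ m, IsMeetOf Γ.le {x, y} m ∧
      Γ.graph.dist x m + Γ.graph.dist m y = Γ.graph.dist x y := by
  obtain ⟨m, ⟨h1, h2⟩, h3⟩ :=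
    Γ.reverse.exists_join ((Γ.reverse_le _ _).2 hx) ((Γ.reverse_le _ _).2 hy)
  rw [reverse_graph] at h3
  exact ⟨m, ⟨fun a ha => (Γ.reverse_le _ _).1 (h1 a ha),
    fun v hv => (Γ.reverse_le _ _).1 (h2 v fun a ha => (Γ.reverse_le _ _).2 (hv a ha))⟩, h3⟩

end ModularComplex

/-! ## Valuations and modularity -/

theorem isModularLatticeOrder_of_isValuation {α : Type*} {r : α → α → Prop} [IsPartialOrder α r]
    {v : α → ℝ} (hv : IsValuation r v) (hub : ∀ x y, ∃ u, r x u ∧ r y u) :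
    IsModularLatticeOrder r := by
  choose inf sup hinf hsup hadd using fun x y => hv.add_eq x y (hub x y)
  let L : Lattice α :=
    { le := r
      le_refl := refl_of r
      le_trans := fun _ _ _ => trans_of r
      le_antisymm := fun _ _ => antisymm_of r
      sup := sup
      inf := inf
      le_sup_left := fun x y => (hsup x y).1 x (by simp)
      le_sup_right := fun x y => (hsup x y).1 y (by simp)
      sup_le := fun x y z hx hy => (hsup x y).2 z (by rintro _ (rfl | rfl) <;> assumption)
      inf_le_left := fun x y => (hinf x y).1 x (by simp)
      inf_le_right := fun x y => (hinf x y).1 y (by simp)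
      le_inf := fun z x y hx hy => (hinf x y).2 z (by rintro _ (rfl | rfl) <;> assumption) }
  have hadd : ∀ x y : α, v x + v y = v (x ⊓ y) + v (x ⊔ y) := hadd
  refine ⟨L, fun _ _ => Iff.rfl, ⟨fun {x} y {z} hxz => ?_⟩⟩
  -- The two comparable sides of the modular law have equal valuation, so strict monotonicity makes
  -- them equal.
  have hle : x ⊔ y ⊓ z ≤ (x ⊔ y) ⊓ z :=
    sup_le (le_inf le_sup_left hxz) (inf_le_inf_right z le_sup_right)
  by_contra hne
  have h0 := hv.pos _ _ hle fun h => hne h.ge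
  have h1 := hadd (x ⊔ y) z
  have h2 := hadd x (y ⊓ z)
  have h3 := hadd x y
  have h4 := hadd y z
  have e1 : x ⊔ y ⊔ z = y ⊔ z := by
    rw [sup_comm x y, sup_assoc, sup_eq_right.2 hxz]
  have e2 : x ⊓ (y ⊓ z) = x ⊓ y := by
    rw [inf_comm y z, ← inf_assoc, inf_eq_left.2 hxz]
  rw [e1] at h1
  rw [e2] at h2
  linarith

theorem IsValuation.principalIdeal {α : Type*} {r : α → α → Prop} [IsPartialOrder α r]
    {v : α → ℝ} (hv : IsValuation r v) (q : α) :
    IsValuation (fun a b : {x // r x q} => r a.1 b.1) (fun a => v a.1) where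
  pos x y h hne := hv.pos x.1 y.1 h fun h => hne (Subtype.ext h)
  add_eq x y _ := by
    obtain ⟨m, j, hm, hj, h⟩ := hv.add_eq x.1 y.1 ⟨q, x.2, y.2⟩
    refine ⟨⟨m, trans_of r (hm.1 x.1 (by simp)) x.2⟩,
      ⟨j, hj.2 q (by rintro _ (rfl | rfl); exacts [x.2, y.2])⟩, ⟨?_, fun u hu => ?_⟩,
      ⟨?_, fun u hu => ?_⟩, h⟩
    · rintro _ (rfl | rfl)
      exacts [hm.1 _ (by simp), hm.1 _ (by simp)]
    · exact hm.2 u.1 (by rintro _ (rfl | rfl); exacts [hu x (by simp), hu y (by simp)])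
    · rintro _ (rfl | rfl)
      exacts [hj.1 _ (by simp), hj.1 _ (by simp)]
    · exact hj.2 u.1 (by rintro _ (rfl | rfl); exacts [hu x (by simp), hu y (by simp)])

theorem IsValuation.principalIdeal_modular {α : Type*} {r : α → α → Prop} [IsPartialOrder α r]
    {v : α → ℝ} (hv : IsValuation r v) (q : α) :
    IsModularLatticeOrder (fun a b : {x // r x q} => r a.1 b.1) := by
  have : IsPartialOrder {x // r x q} (fun a b => r a.1 b.1) :=
    { refl := fun a => refl_of r a.1
      trans := fun _ _ _ => trans_of r
      antisymm := fun _ _ h h' => Subtype.ext (antisymm_of r h h') }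
  exact isModularLatticeOrder_of_isValuation (hv.principalIdeal q)
    fun x y => ⟨⟨q, refl_of r q⟩, x.2, y.2⟩

/-! ## Extended modular complexes -/

namespace ExtendedModularComplex

variable {V : Type*} (Γ : ExtendedModularComplex V)

/-- The extended modular complex with all edges and the relation `⊑` reversed. -/
def reverse : ExtendedModularComplex V where
  toModularComplex := Γ.toModularComplex.reverse
  sqle p q := Γ.sqle q p
  sqle_admissible :=
    have hle := Γ.toModularComplex.reverse_le
    have h := Γ.sqle_admissible
    { le_of_rel := fun p q hpq => (hle p q).2 (h.le_of_rel q p hpq)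
      refl := h.refl
      of_arc := fun p q => h.of_arc q p
      interval := fun p q a b hpq hab hpa haq hpb hbq =>
        h.interval q p b a hpq ((hle _ _).1 hab) ((hle _ _).1 hbq) ((hle _ _).1 hpb)
          ((hle _ _).1 haq) ((hle _ _).1 hpa)
      join := fun p q₁ q₂ q h₁ h₂ hq => h.meet q₁ q₂ p q h₁ h₂
        ⟨fun x hx => (hle _ _).1 (hq.1 x hx),
          fun u hu => (hle _ _).1 (hq.2 u fun x hx => (hle _ _).2 (hu x hx))⟩
      meet := fun p₁ p₂ q p h₁ h₂ hp => h.join q p₁ p₂ p h₁ h₂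
        ⟨fun x hx => (hle _ _).1 (hp.1 x hx),
          fun u hu => (hle _ _).1 (hp.2 u fun x hx => (hle _ _).2 (hu x hx))⟩ }

theorem reverse_unitMetric : Γ.reverse.unitMetric = Γ.unitMetric := by
  have h : Γ.reverse.graph = Γ.graph := Γ.toModularComplex.reverse_graph
  unfold OrientedWeightedGraph.unitMetric
  rw [h]

theorem reverse_pathMetric : Γ.reverse.pathMetric = Γ.pathMetric := by
  have h : Γ.reverse.graph = Γ.graph := Γ.toModularComplex.reverse_graph
  have hw : Γ.reverse.w = Γ.w := rfl
  unfold OrientedWeightedGraph.pathMetric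
  rw [h, hw]

theorem reverse_plusOrder (p : V) : Γ.reverse.plusOrder p = Γ.minusOrder p := by
  funext a b
  exact propext (Γ.toModularComplex.reverse_le a.1 b.1)

/-! ### The semilattice `Lplus` -/

variable {Γ} {p : V}

theorem le_of_mem_Lplus {x : V} (hx : x ∈ Γ.Lplus p) : Γ.le p x :=
  Γ.sqle_admissible.le_of_rel _ _ hx

theorem mem_Lplus_of_le {x a : V} (hx : x ∈ Γ.Lplus p) (hpa : Γ.le p a) (hax : Γ.le a x) :
    a ∈ Γ.Lplus p :=
  Γ.sqle_admissible.interval p x p a hx hpa .refl (le_of_mem_Lplus hx) hpa hax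

theorem mem_Lplus_of_isJoinOf {x y j : V} (hx : x ∈ Γ.Lplus p) (hy : y ∈ Γ.Lplus p)
    (hj : IsJoinOf Γ.le {x, y} j) : j ∈ Γ.Lplus p :=
  Γ.sqle_admissible.join p x y j hx hy hj

theorem isJoinOf_plusOrder {x y j : Γ.Lplus p} (hj : IsJoinOf Γ.le {x.1, y.1} j.1) :
    IsJoinOf (Γ.plusOrder p) {x, y} j := by
  refine ⟨?_, fun u hu => hj.2 u.1 ?_⟩
  · rintro _ (rfl | rfl)
    exacts [hj.1 _ (by simp), hj.1 _ (by simp)]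
  · rintro _ (rfl | rfl)
    exacts [hu x (by simp), hu y (by simp)]

theorem isMeetOf_plusOrder {x y m : Γ.Lplus p} (hm : IsMeetOf Γ.le {x.1, y.1} m.1) :
    IsMeetOf (Γ.plusOrder p) {x, y} m := by
  refine ⟨?_, fun u hu => hm.2 u.1 ?_⟩
  · rintro _ (rfl | rfl)
    exacts [hm.1 _ (by simp), hm.1 _ (by simp)]
  · rintro _ (rfl | rfl)
    exacts [hu x (by simp), hu y (by simp)]


variable [Finite V]

theorem isPartialOrder_plusOrder : IsPartialOrder (Γ.Lplus p) (Γ.plusOrder p) where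
  refl _ := .refl
  trans _ _ _ := .trans
  antisymm _ _ h h' := Subtype.ext (Γ.le_antisymm h h')

/-- Only `p ⪯ y` is required of `y`, so this applies to points not yet known to lie in `Lplus`. -/
theorem exists_meet_Lplus {x y : V} (hx : x ∈ Γ.Lplus p) (hy : Γ.le p y) :
    ∃ m ∈ Γ.Lplus p, IsMeetOf Γ.le {x, y} m ∧
      Γ.graph.dist x m + Γ.graph.dist m y = Γ.graph.dist x y := by
  have hp := le_of_mem_Lplus hx
  obtain ⟨m, hm, hd⟩ := Γ.exists_meet hp hy
  exact ⟨m, mem_Lplus_of_le hx (hm.2 p (by rintro _ (rfl | rfl) <;> assumption))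
    (hm.1 x (by simp)), hm, hd⟩

theorem mem_Lplus_of_between {x y z : V} (hx : x ∈ Γ.Lplus p) (hy : y ∈ Γ.Lplus p)
    (hz : Γ.graph.dist x z + Γ.graph.dist z y = Γ.graph.dist x y) : z ∈ Γ.Lplus p := by
  have hpz := Γ.le_of_between_of_le (le_of_mem_Lplus hx) (le_of_mem_Lplus hy) hz
  obtain ⟨a, ha, ham, had⟩ := exists_meet_Lplus hx hpz
  obtain ⟨b, hb, hbm, hbd⟩ := exists_meet_Lplus hy hpz
  have haz := ham.1 z (by simp)
  have hbz := hbm.1 z (by simp)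
  obtain ⟨j, hj, -⟩ := Γ.exists_join haz hbz
  have hjz := hj.2 z (by rintro _ (rfl | rfl) <;> assumption)
  have h1 := Γ.dist_add_of_le (hj.1 a (by simp)) hjz
  have h2 := Γ.dist_add_of_le (hj.1 b (by simp)) hjz
  have h3 := Γ.dist_triangle x a j
  have h4 := Γ.dist_triangle y b j
  have h5 := Γ.dist_triangle x j y
  have h6 := Γ.dist_comm j y
  have h7 := Γ.dist_comm z y
  -- Passing through `a`, `b` and `j` would shorten the geodesic through `z` by `2 d(j,z)`.
  have : j = z := Γ.dist_eq_zero_iff.1 (by omega)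
  exact this ▸ mem_Lplus_of_isJoinOf ha hb hj

theorem isMetricConvex_unitMetric_Lplus : IsMetricConvex Γ.unitMetric (Γ.Lplus p) := by
  intro x hx y hy z hz
  refine mem_Lplus_of_between hx hy ?_
  simp only [metricInterval, OrientedWeightedGraph.unitMetric, Set.mem_ofPred_eq] at hz
  exact_mod_cast hz

theorem isMetricConvex_pathMetric_Lplus : IsMetricConvex Γ.pathMetric (Γ.Lplus p) := by
  intro x hx y hy z hz
  obtain ⟨i, hd, hI⟩ := Γ.pathMetric_spec
  simp only [metricInterval, hd, Set.mem_ofPred_eq] at hz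
  exact mem_Lplus_of_between hx hy ((hI _ _ _).1 hz)

theorem isValuation_Lplus : IsValuation (Γ.plusOrder p) (fun a => Γ.pathMetric p a.1) := by
  obtain ⟨i, hd, hI⟩ := Γ.pathMetric_spec
  have hle : ∀ {a b c : V}, Γ.le a b → Γ.le b c → dist a b + dist b c = dist a c :=
    fun h h' => (hI _ _ _).2 (Γ.dist_add_of_le h h')
  simp only [hd]
  refine ⟨fun x y hxy hne => ?_, fun x y ⟨u, hxu, hyu⟩ => ?_⟩
  · have h1 := hle (le_of_mem_Lplus x.2) hxy
    have h2 := dist_pos.2 fun h => hne (Subtype.ext h)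
    linarith
  · obtain ⟨m, hm, hm', hmd⟩ := exists_meet_Lplus x.2 (le_of_mem_Lplus y.2)
    obtain ⟨j, hj, hjd⟩ := Γ.exists_join hxu hyu
    refine ⟨⟨m, hm⟩, ⟨j, mem_Lplus_of_isJoinOf x.2 y.2 hj⟩, isMeetOf_plusOrder hm',
      isJoinOf_plusOrder hj, ?_⟩
    have hpm := le_of_mem_Lplus hm
    have hmx := hm'.1 x.1 (by simp)
    have hmy := hm'.1 y.1 (by simp)
    have hxj := hj.1 x.1 (by simp)
    have hyj := hj.1 y.1 (by simp)
    have h1 := hle hpm hmx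
    have h2 := hle hpm hmy
    have h3 := hle (hpm.trans hmx) hxj
    have h4 := hle (hpm.trans hmy) hyj
    have h5 := (hI _ _ _).2 hmd
    have h6 := (hI _ _ _).2 hjd
    rw [dist_comm x.1 m] at h5
    rw [dist_comm j y.1] at h6
    simp only
    linarith

theorem isModularSemilattice_Lplus : IsModularSemilattice (Γ.plusOrder p) where
  isPartialOrder := isPartialOrder_plusOrder
  exists_meet x y := by
    obtain ⟨m, hm, hm', -⟩ := exists_meet_Lplus x.2 (le_of_mem_Lplus y.2)
    exact ⟨⟨m, hm⟩, isMeetOf_plusOrder hm'⟩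
  ideal_modular q :=
    have := isPartialOrder_plusOrder (Γ := Γ) (p := p)
    isValuation_Lplus.principalIdeal_modular q
  exists_join := by
    rintro x y z ⟨a, ha, -⟩ ⟨b, hb, -⟩ ⟨c, hc, -⟩
    have hxa : Γ.le x.1 a.1 := ha x (by simp)
    have hya : Γ.le y.1 a.1 := ha y (by simp)
    have hyb : Γ.le y.1 b.1 := hb y (by simp)
    have hzb : Γ.le z.1 b.1 := hb z (by simp)
    have hzc : Γ.le z.1 c.1 := hc z (by simp)
    have hxc : Γ.le x.1 c.1 := hc x (by simp)
    -- The bound `u` need not be in `Lplus`; it only guarantees joins in `Γ`, which axiom (b) then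
    -- places in `Lplus`.
    obtain ⟨u, h1, h2, h3⟩ := Γ.exists_median a.1 b.1 c.1
    have hxu := Γ.le_of_between_of_le hxa hxc h3
    have hyu := Γ.le_of_between_of_le hya hyb h1
    have hzu := Γ.le_of_between_of_le hzb hzc h2
    obtain ⟨j, hj, -⟩ := Γ.exists_join hxu hyu
    have hju := hj.2 u (by rintro _ (rfl | rfl) <;> assumption)
    obtain ⟨k, hk, -⟩ := Γ.exists_join hju hzu
    have hxj := hj.1 x.1 (by simp)
    have hyj := hj.1 y.1 (by simp)
    have hjk := hk.1 j (by simp)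
    have hzk := hk.1 z.1 (by simp)
    refine ⟨⟨k, mem_Lplus_of_isJoinOf (mem_Lplus_of_isJoinOf x.2 y.2 hj) z.2 hk⟩, ?_, ?_⟩
    · rintro _ (rfl | rfl | rfl)
      exacts [hxj.trans hjk, hyj.trans hjk, hzk]
    · intro v hv
      refine hk.2 v.1 ?_
      rintro _ (rfl | rfl)
      · refine hj.2 v.1 ?_
        rintro _ (rfl | rfl)
        exacts [hv x (by simp), hv y (by simp)]
      · exact hv z (by simp)

end ExtendedModularComplex

theorem mainTheorem12 {V : Type*} [Finite V] (Γ : ExtendedModularComplex V) (p : V) :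
    (IsModularSemilattice (Γ.plusOrder p) ∧
      IsMetricConvex Γ.pathMetric (Γ.Lplus p) ∧
      IsMetricConvex Γ.unitMetric (Γ.Lplus p) ∧
      IsValuation (Γ.plusOrder p) (fun a => Γ.pathMetric p a.1)) ∧
    (IsModularSemilattice (Γ.minusOrder p) ∧
      IsMetricConvex Γ.pathMetric (Γ.Lminus p) ∧
      IsMetricConvex Γ.unitMetric (Γ.Lminus p) ∧
      IsValuation (Γ.minusOrder p) (fun a => Γ.pathMetric p a.1)) := by
  have key : ∀ Γ : ExtendedModularComplex V, IsModularSemilattice (Γ.plusOrder p) ∧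
      IsMetricConvex Γ.pathMetric (Γ.Lplus p) ∧ IsMetricConvex Γ.unitMetric (Γ.Lplus p) ∧
      IsValuation (Γ.plusOrder p) (fun a => Γ.pathMetric p a.1) := fun Γ =>
    ⟨Γ.isModularSemilattice_Lplus, Γ.isMetricConvex_pathMetric_Lplus,
      Γ.isMetricConvex_unitMetric_Lplus, Γ.isValuation_Lplus⟩
  -- `Γ.reverse.Lplus p` is `Γ.Lminus p` by definition, so only the order and the metrics need
  -- rewriting.
  have h := key Γ.reverse
  rw [Γ.reverse_plusOrder, Γ.reverse_pathMetric, Γ.reverse_unitMetric] at h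
  exact ⟨key Γ, h⟩
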